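/- Let $\sigma$ be a smooth, strictly convex, closed curve in $\mathbb R^2$, that is, a smooth regular closed curve, not necessarily of constant speed, whose unit tangent map from the parameter circle to the unit circle $\mathbb S^1$ is a diffeomorphism of degree one (in particular, $\sigma$ is traversed counterclockwise and its curvature is positive). Let $L$ be its length, $s$ its arc length parameter, $\kappa>0$ its curvature, and $\nabla\kappa=d\kappa/ds$. Set $$\mathcal E_G[\sigma]=\int_\sigma \frac{|\nabla\kappa|^2}{4\kappa^3}-\frac{(2\pi)^2}{L^2}\frac1\kappa\,ds+2\pi,\qquad \mathcal E_G^*[\sigma]=\int_\sigma \frac{|\nabla\kappa|^2}{4\kappa^2}-\kappa^2\,ds+\frac{(2\pi)^2}{L}.$$ Let $T_\sigma:\mathbb S^1\to\mathbb S^1$ be the unit tangent map of the constant-speed parametrization of $\sigma$ by $\mathbb S^1$, so that $T_\sigma(\cos\frac{2\pi s}{L},\sin\frac{2\pi s}{L})$ is the unit tangent vector at the point with arc length parameter $s$. Let $T_0(\cos\theta,\sin\theta)=(-\sin\theta,\cos\theta)$. The family $\mathcal O$ of Benguria–Loss ovals consists of those $\sigma$ for which the diffeomorphism $\phi_\sigma=T_0^{-1}\circ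 T_\sigma$ of $\mathbb S^1$ has the form $X\mapsto AX/|AX|$ for some $A\in \mathrm{SL}(2,\mathbb R)$. Then: 1. $\mathcal E_G[\sigma]\ge 0$, and $\mathcal E_G[\sigma]=0$ if and only if $\sigma\in\mathcal O$. 2. $\mathcal E_G^*[\sigma]\ge 0$, and $\mathcal E_G^*[\sigma]=0$ if and only if $\sigma\in\mathcal O$. -/

import Mathlib

open scoped ContDiff

noncomputable section

/-- The Euclidean plane `ℝ²`. -/
abbrev Plane : Type := EuclideanSpace ℝ (Fin 2)

/-- A smooth closed plane curve: a smooth immersion of the circle `ℝ / 2πℤ` into `ℝ²`, written as a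
`2π`-periodic map on `ℝ`. The parametrization need not have constant speed. -/
structure SmoothClosedCurve where
  toFun : ℝ → Plane
  smooth : ContDiff ℝ ∞ toFun
  periodic : Function.Periodic toFun (2 * Real.pi)
  immersion : ∀ t, deriv toFun t ≠ 0

namespace SmoothClosedCurve

/-- `|σ'(t)|`; the length element is `ds = |σ'(t)| dt`. -/
def speed (σ : SmoothClosedCurve) (t : ℝ) : ℝ := ‖deriv σ.toFun t‖

/-- The unit tangent vector `σ'(t) / |σ'(t)|`. -/
def unitTangent (σ : SmoothClosedCurve) (t : ℝ) : Plane :=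
  (σ.speed t)⁻¹ • deriv σ.toFun t

/-- Arc length from the base point `σ(0)`. -/
def arcLength (σ : SmoothClosedCurve) (t : ℝ) : ℝ := ∫ u in (0 : ℝ)..t, σ.speed u

/-- The length `L(σ)`. -/
def length (σ : SmoothClosedCurve) : ℝ := σ.arcLength (2 * Real.pi)

/-- The (signed) geodesic curvature `(x' y'' - y' x'') / |σ'|³`. -/
def curvature (σ : SmoothClosedCurve) (t : ℝ) : ℝ :=
  (deriv σ.toFun t 0 * deriv (deriv σ.toFun) t 1
    - deriv σ.toFun t 1 * deriv (deriv σ.toFun) t 0) / σ.speed t ^ 3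

/-- The intrinsic gradient of a function along the curve: its derivative with respect to
arc length. -/
def grad (σ : SmoothClosedCurve) (f : ℝ → ℝ) (t : ℝ) : ℝ := deriv f t / σ.speed t

/-- The integral `∫_σ f ds` over one period. -/
def integral (σ : SmoothClosedCurve) (f : ℝ → ℝ) : ℝ :=
  ∫ t in (0 : ℝ)..(2 * Real.pi), f t * σ.speed t

/-- The curve is strictly convex: its unit tangent map, as a map from the parameter circle
`ℝ / 2πℤ` to the unit circle, has degree one and is a diffeomorphism. This is expressed by a
lift `ϑ : ℝ → ℝ` (tangent angle) that is smooth with smooth inverse and satisfies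
`ϑ (t + 2π) = ϑ t + 2π`. -/
def StrictlyConvex (σ : SmoothClosedCurve) : Prop :=
  ∃ ϑ η : ℝ → ℝ, ContDiff ℝ ∞ ϑ ∧ ContDiff ℝ ∞ η ∧
    Function.LeftInverse η ϑ ∧ Function.RightInverse η ϑ ∧
    (∀ t, ϑ (t + 2 * Real.pi) = ϑ t + 2 * Real.pi) ∧
    ∀ t, σ.unitTangent t = !₂[Real.cos (ϑ t), Real.sin (ϑ t)]

/-- `𝓔_G[σ] = ∫_σ |∇κ|² / (4 κ³) - ((2π)² / L²) (1 / κ) ds + 2π`. -/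
def energyG (σ : SmoothClosedCurve) : ℝ :=
  σ.integral (fun t => (σ.grad σ.curvature t) ^ 2 / (4 * σ.curvature t ^ 3)
    - (2 * Real.pi) ^ 2 / σ.length ^ 2 * (1 / σ.curvature t)) + 2 * Real.pi

/-- `𝓔_G^*[σ] = ∫_σ |∇κ|² / (4 κ²) - κ² ds + (2π)² / L`. -/
def energyGStar (σ : SmoothClosedCurve) : ℝ :=
  σ.integral (fun t => (σ.grad σ.curvature t) ^ 2 / (4 * σ.curvature t ^ 2)
    - σ.curvature t ^ 2) + (2 * Real.pi) ^ 2 / σ.length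

end SmoothClosedCurve

/-- The covering map `ℝ → 𝕊¹ ⊂ ℝ²`. -/
def circlePoint (x : ℝ) : Plane := !₂[Real.cos x, Real.sin x]

/-- The unit tangent map of the standard counterclockwise unit circle:
`(cos θ, sin θ) ↦ (-sin θ, cos θ)`. -/
def standardTangent (p : Plane) : Plane := !₂[-(p 1), p 0]

/-- The Möbius transformation `X ↦ A X / |A X|` of `𝕊¹` given by `A ∈ SL(2, ℝ)`. -/
def moebius (A : Matrix.SpecialLinearGroup (Fin 2) ℝ) (p : Plane) : Plane :=
  ‖Matrix.toEuclideanLin A.1 p‖⁻¹ • Matrix.toEuclideanLin A.1 p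

/-- The Benguria–Loss ovals `𝓞`: strictly convex curves whose induced diffeomorphism
`φ_σ` of `𝕊¹` is a Möbius transformation. Here `φ_σ` is determined by
`T_σ = standardTangent ∘ φ_σ`, where `T_σ : 𝕊¹ → 𝕊¹` is the unit tangent map of the
constant-speed parametrization of the curve by `𝕊¹`: the point `σ(t)` has the constant-speed
parameter `2π s(t) / L`, with `s` the arc length from `σ(0)`. -/
def SmoothClosedCurve.IsOval (σ : SmoothClosedCurve) : Prop :=
  σ.StrictlyConvex ∧ ∃ A : Matrix.SpecialLinearGroup (Fin 2) ℝ, ∀ t : ℝ,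
    σ.unitTangent t =
      standardTangent (moebius A (circlePoint (2 * Real.pi * σ.arcLength t / σ.length)))

end

open Real Set Filter Topology

/-! Let ϑ be the tangent angle and s the arc length rescaled to total length 2π. With g = ϑ ∘ s⁻¹,
the energy 𝓔_G is `liftEnergy g`; with g = s ∘ ϑ⁻¹, 𝓔_G^* is (2π/L) `liftEnergy g`. For every circle
diffeomorphism g, `liftEnergy g` is the sum of the values of ∫ W'² - W² at W = cos g / √g' and W =
sin g / √g' (`liftEnergy_eq`).

That form is negative on constants, but it is nonnegative once W(b) + W(b + π) = 0 for some b: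
subtracting W(b) cos(y - b) does not change it and leaves a function vanishing at b and b + π, to
which the Dirichlet Wirtinger inequality applies on each half circle (`wirtinger_of_antipodal`).

Closedness of the curve supplies b. If W(y) + W(y + π) never vanished, comparing g with its
antipodal conjugate g(y + π) - π through tangents would make g unbalanced (`isUnbalanced_of_pos`).
This contradicts the closing condition, which reads ∫ cos g = ∫ sin g = 0 for the first g and ∫ cos
y g' = ∫ sin y g' = 0 for the second. The sine follows by replacing g with g - π/2.

Equality forces both functions W to be combinations of cos y and sin y, so (cos g, sin g) = √g' B
(cos y, sin y). Since their Wronskian is 1, det B = 1 and g is a Möbius transformation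
(`moebiusRelated_iff`). -/

/-! ### Wirtinger's inequality and the form ∫ W'² - W². -/

/-- `U² cot` extends continuously by zero to the zeros of `sin` at which `U` vanishes. -/
lemma continuousAt_sq_mul_cot {U : ℝ → ℝ} (hU : Differentiable ℝ U) {b : ℝ}
    (hb : sin b = 0 → U b = 0) : ContinuousAt (fun y => U y ^ 2 * cos y / sin y) b := by
  by_cases h : sin b = 0
  · have hUb := hb h
    -- Both `U` and `sin` vanish at `b`, so `U / sin` is a quotient of slopes, whose denominator
    -- tends to `cos b ≠ 0`.
    have e : (fun y => U y ^ 2 * cos y / sin y)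
        = fun y => U y * cos y * (dslope U b y / dslope sin b y) := by
      funext y
      by_cases hy : y = b
      · subst hy; simp [hUb]
      · rw [dslope_of_ne _ hy, dslope_of_ne _ hy, slope_def_field, slope_def_field, hUb, h]
        have : y - b ≠ 0 := sub_ne_zero.2 hy
        rw [sub_zero, sub_zero, div_div_div_cancel_right₀ this]
        ring
    rw [e]
    have hc : cos b ≠ 0 := by
      intro hc
      have := sin_sq_add_cos_sq b
      simp [h, hc] at this
    refine ((hU b).continuousAt.mul continuous_cos.continuousAt).mul
      (ContinuousAt.div ?_ ?_ ?_)
    · exact continuousAt_dslope_same.2 (hU b)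
    · exact continuousAt_dslope_same.2 (differentiable_sin b)
    · rw [dslope_same]; simpa using hc
  · exact (((hU b).continuousAt.pow 2).mul continuous_cos.continuousAt).div
      continuous_sin.continuousAt h

/-- Wirtinger's inequality between two consecutive zeros of `sin`. -/
lemma wirtinger_between_zeros {U : ℝ → ℝ} (hU : ContDiff ℝ ∞ U) {b c : ℝ} (hbc : b ≤ c)
    (hs : ∀ y ∈ Ioo b c, sin y ≠ 0) (hb : sin b = 0) (hc : sin c = 0)
    (hUb : U b = 0) (hUc : U c = 0) :
    0 ≤ ∫ y in b..c, (deriv U y ^ 2 - U y ^ 2) ∧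
    ((∫ y in b..c, (deriv U y ^ 2 - U y ^ 2)) ≤ 0 →
      ∀ y ∈ Icc b c, deriv U y * sin y = U y * cos y) := by
  have hd : Differentiable ℝ U := hU.differentiable (by simp)
  have hd' : Continuous (deriv U) := hU.continuous_deriv (by simp)
  have hφ : Continuous fun y => deriv U y ^ 2 - U y ^ 2 :=
    (hd'.pow 2).sub (hd.continuous.pow 2)
  -- Jacobi's completion of the square: U'² - U² - (U² cot)' = (U' - U cot)². The cotangent term is
  -- 0 at both endpoints, so `G` rises from 0 to the full integral.
  set G : ℝ → ℝ := fun y => (∫ x in b..y, (deriv U x ^ 2 - U x ^ 2)) - U y ^ 2 * cos y / sin y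
    with hG
  have hGd : ∀ y ∈ Ioo b c, HasDerivAt G ((deriv U y - U y * cos y / sin y) ^ 2) y := by
    intro y hy
    have h0 := hs y hy
    have h1 : HasDerivAt (fun y => ∫ x in b..y, (deriv U x ^ 2 - U x ^ 2))
        (deriv U y ^ 2 - U y ^ 2) y :=
      hφ.integral_hasStrictDerivAt b y |>.hasDerivAt
    have h2 := ((((hd y).hasDerivAt.pow 2).mul (hasDerivAt_cos y)).div (hasDerivAt_sin y) h0)
    refine (h1.sub h2).congr_deriv ?_
    simp only [Pi.pow_apply, Pi.mul_apply]
    field_simp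
    ring
  have hGc : ContinuousOn G (Icc b c) := by
    intro y hy
    refine ContinuousAt.continuousWithinAt (ContinuousAt.sub ?_ (continuousAt_sq_mul_cot hd ?_))
    · exact (hφ.integral_hasStrictDerivAt b y).hasDerivAt.continuousAt
    · intro h
      rcases eq_or_lt_of_le hy.1 with h1 | h1
      · rw [← h1, hUb]
      rcases eq_or_lt_of_le hy.2 with h2 | h2
      · rw [h2, hUc]
      exact absurd h (hs y ⟨h1, h2⟩)
  have hGm : MonotoneOn G (Icc b c) := by
    refine monotoneOn_of_deriv_nonneg (convex_Icc b c) hGc ?_ ?_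
    · rw [interior_Icc]
      exact fun y hy => (hGd y hy).differentiableAt.differentiableWithinAt
    · rw [interior_Icc]
      intro y hy
      rw [(hGd y hy).deriv]; positivity
  have hGb : G b = 0 := by simp [hG, hUb]
  have hGc' : G c = ∫ y in b..c, (deriv U y ^ 2 - U y ^ 2) := by simp [hG, hUc]
  have hle := hGm (left_mem_Icc.2 hbc) (right_mem_Icc.2 hbc) hbc
  refine ⟨by rw [← hGc', ← hGb]; exact hle, fun h y hy => ?_⟩
  rcases eq_or_lt_of_le hy.1 with h1 | h1
  · rw [← h1, hUb, hb]; simp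
  rcases eq_or_lt_of_le hy.2 with h2 | h2
  · rw [h2, hUc, hc]; simp
  -- A nonpositive integral pins the monotone `G` between 0 and 0.
  have hz : G =ᶠ[𝓝 y] fun _ => 0 := by
    filter_upwards [Ioo_mem_nhds h1 h2] with x hx
    have hx' := Ioo_subset_Icc_self hx
    have a1 := hGm (left_mem_Icc.2 hbc) hx' hx.1.le
    have a2 := hGm hx' (right_mem_Icc.2 hbc) hx.2.le
    rw [hGb] at a1; rw [hGc'] at a2; linarith
  have h3 := (hGd y ⟨h1, h2⟩).unique ((hasDerivAt_const y (0 : ℝ)).congr_of_eventuallyEq hz)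
  have h4 := pow_eq_zero_iff (two_ne_zero) |>.1 h3
  have := hs y ⟨h1, h2⟩
  field_simp at h4
  linarith

/-- A solution of `U'' + U = 0` is a combination of `cos` and `sin`. -/
lemma eq_trig_of_deriv_deriv_add_self {U : ℝ → ℝ} (hU : ContDiff ℝ ∞ U)
    (h : ∀ y, deriv (deriv U) y + U y = 0) (y : ℝ) :
    U y = U 0 * cos y + deriv U 0 * sin y := by
  have hd : Differentiable ℝ U := hU.differentiable (by simp)
  have hd' : Differentiable ℝ (deriv U) :=
    (contDiff_infty_iff_deriv.1 hU).2.differentiable (by simp)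
  -- The two first integrals are the coordinates of (U, U') rotated by the angle y; undoing the
  -- rotation gives the formula.
  have h1 : ∀ y, HasDerivAt (fun y => U y * sin y + deriv U y * cos y) 0 y := fun y => by
    refine (((hd y).hasDerivAt.mul (hasDerivAt_sin y)).add
      ((hd' y).hasDerivAt.mul (hasDerivAt_cos y))).congr_deriv ?_
    linear_combination cos y * h y
  have h2 : ∀ y, HasDerivAt (fun y => U y * cos y - deriv U y * sin y) 0 y := fun y => by
    refine (((hd y).hasDerivAt.mul (hasDerivAt_cos y)).sub
      ((hd' y).hasDerivAt.mul (hasDerivAt_sin y))).congr_deriv ?_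
    linear_combination -sin y * h y
  have e1 := is_const_of_deriv_eq_zero (fun y => (h1 y).differentiableAt)
    (fun y => (h1 y).deriv) y 0
  have e2 := is_const_of_deriv_eq_zero (fun y => (h2 y).differentiableAt)
    (fun y => (h2 y).deriv) y 0
  simp at e1 e2
  linear_combination sin y * e1 + cos y * e2 - U y * sin_sq_add_cos_sq y

/-- The quadratic form `∫ W'² - W²` over one period. -/
noncomputable def trigForm (W : ℝ → ℝ) : ℝ :=
  ∫ y in (0 : ℝ)..(2 * π), (deriv W y ^ 2 - W y ^ 2)

lemma periodic_deriv {W : ℝ → ℝ} {T : ℝ} (hp : Function.Periodic W T) :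
    Function.Periodic (deriv W) T := by
  intro y
  rw [← deriv_comp_add_const]
  congr 1
  exact funext hp

/-- With v = a cos + b sin, the identity v'' = -v makes the difference of the integrands the
derivative of -2Wv' + vv', which is periodic. -/
lemma trigForm_sub_trig {W : ℝ → ℝ} (hW : ContDiff ℝ ∞ W)
    (hp : Function.Periodic W (2 * π)) (a b : ℝ) :
    trigForm (fun y => W y - (a * cos y + b * sin y)) = trigForm W := by
  have hd : Differentiable ℝ W := hW.differentiable (by simp)
  have hd' : Continuous (deriv W) := hW.continuous_deriv (by simp)
  unfold trigForm
  rw [← sub_eq_zero, ← intervalIntegral.integral_sub]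
  rotate_left
  · refine Continuous.intervalIntegrable ?_ _ _
    have : ContDiff ℝ ∞ (fun y => W y - (a * cos y + b * sin y)) := by fun_prop
    have := this.continuous_deriv (by simp)
    fun_prop
  · exact Continuous.intervalIntegrable (by fun_prop) _ _
  have hder : ∀ y ∈ uIcc 0 (2 * π), HasDerivAt
      (fun y => -2 * W y * (b * cos y - a * sin y)
        + (a * cos y + b * sin y) * (b * cos y - a * sin y))
      (deriv (fun y => W y - (a * cos y + b * sin y)) y ^ 2 - (W y - (a * cos y + b * sin y)) ^ 2 -
        (deriv W y ^ 2 - W y ^ 2)) y := by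
    intro y _
    have hW' := (hd y).hasDerivAt
    have ht : HasDerivAt (fun y => a * cos y + b * sin y) (a * -sin y + b * cos y) y :=
      ((hasDerivAt_cos y).const_mul a).add ((hasDerivAt_sin y).const_mul b)
    have ht' : HasDerivAt (fun y => b * cos y - a * sin y) (b * -sin y - a * cos y) y :=
      ((hasDerivAt_cos y).const_mul b).sub ((hasDerivAt_sin y).const_mul a)
    rw [show deriv (fun y => W y - (a * cos y + b * sin y)) y
      = deriv W y - (a * -sin y + b * cos y) from (hW'.sub ht).deriv]
    refine (((hW'.const_mul (-2)).mul ht').add (ht.mul ht')).congr_deriv ?_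
    ring
  rw [intervalIntegral.integral_eq_sub_of_hasDerivAt hder]
  · have := hp 0
    simp only [zero_add] at this
    simp [this]
  · refine Continuous.intervalIntegrable ?_ _ _
    have : ContDiff ℝ ∞ (fun y => W y - (a * cos y + b * sin y)) := by fun_prop
    have := this.continuous_deriv (by simp)
    fun_prop

lemma trigForm_trig (a b : ℝ) : trigForm (fun y => a * cos y + b * sin y) = 0 := by
  have h := trigForm_sub_trig (W := fun _ => 0) contDiff_const (fun _ => rfl) (-a) (-b)
  have e : (fun y => (0 : ℝ) - (-a * cos y + -b * sin y)) = fun y => a * cos y + b * sin y := by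
    funext y; ring
  rw [e] at h
  rw [h]; simp [trigForm]

lemma trigForm_comp_add {W : ℝ → ℝ} (hp : Function.Periodic W (2 * π)) (b : ℝ) :
    trigForm (fun y => W (y + b)) = trigForm W := by
  unfold trigForm
  have hp' := periodic_deriv hp
  have hq : Function.Periodic (fun y => deriv W y ^ 2 - W y ^ 2) (2 * π) := fun y => by
    simp only [hp y, hp' y]
  simp_rw [deriv_comp_add_const]
  rw [intervalIntegral.integral_comp_add_right (fun y => deriv W y ^ 2 - W y ^ 2) b]
  rw [zero_add, add_comm]
  simpa using hq.intervalIntegral_add_eq b 0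

lemma wirtinger_of_zero_of_zero {U : ℝ → ℝ} (hU : ContDiff ℝ ∞ U)
    (hp : Function.Periodic U (2 * π)) (h0 : U 0 = 0) (hpi : U π = 0) :
    0 ≤ trigForm U ∧ (trigForm U ≤ 0 → ∀ y, U y = U 0 * cos y + deriv U 0 * sin y) := by
  have hd : Differentiable ℝ U := hU.differentiable (by simp)
  have hU' : ContDiff ℝ ∞ (deriv U) := (contDiff_infty_iff_deriv.1 hU).2
  have hd' : Differentiable ℝ (deriv U) := hU'.differentiable (by simp)
  have hcd' : Continuous (deriv U) := hd'.continuous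
  have hdd' : Continuous (deriv (deriv U)) := hU'.continuous_deriv (by simp)
  have h2 : U (2 * π) = 0 := by have := hp 0; simpa [h0] using this
  obtain ⟨a1, a2⟩ := wirtinger_between_zeros hU pi_pos.le
    (fun y hy => (sin_pos_of_pos_of_lt_pi hy.1 hy.2).ne') sin_zero sin_pi h0 hpi
  obtain ⟨b1, b2⟩ := wirtinger_between_zeros hU (b := π) (c := 2 * π) (by linarith [pi_pos])
    (fun y hy => by
      have := sin_pos_of_pos_of_lt_pi (x := y - π) (by linarith [hy.1]) (by linarith [hy.2])
      rw [sin_sub_pi] at this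
      linarith) sin_pi sin_two_pi hpi h2
  have hφ : Continuous fun y => deriv U y ^ 2 - U y ^ 2 :=
    (hcd'.pow 2).sub (hd.continuous.pow 2)
  have hsum : trigForm U = (∫ y in (0:ℝ)..π, (deriv U y ^ 2 - U y ^ 2))
      + ∫ y in π..(2*π), (deriv U y ^ 2 - U y ^ 2) :=
    (intervalIntegral.integral_add_adjacent_intervals (hφ.intervalIntegrable _ _)
      (hφ.intervalIntegrable _ _)).symm
  refine ⟨by rw [hsum]; positivity, fun h => ?_⟩
  rw [hsum] at h
  have a3 := a2 (by linarith)
  have b3 := b2 (by linarith)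
  have key : ∀ y, deriv U y * sin y = U y * cos y := by
    have hq : Function.Periodic (fun y => deriv U y * sin y - U y * cos y) (2 * π) := fun y => by
      simp only [hp y, periodic_deriv hp y, sin_add_two_pi, cos_add_two_pi]
    intro y
    obtain ⟨z, hz, e⟩ := hq.exists_mem_Ico₀ two_pi_pos y
    rw [← sub_eq_zero]
    refine e.trans (sub_eq_zero.2 ?_)
    rcases le_total z π with h | h
    · exact a3 z ⟨hz.1, h⟩
    · exact b3 z ⟨h, hz.2.le⟩
  refine eq_trig_of_deriv_deriv_add_self hU ?_
  -- Differentiating U' sin = U cos cancels the mixed terms.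
  have hk : ∀ y, (deriv (deriv U) y + U y) * sin y = 0 := by
    intro y
    have h1 := ((hd' y).hasDerivAt.mul (hasDerivAt_sin y)).sub
      ((hd y).hasDerivAt.mul (hasDerivAt_cos y))
    have e : (deriv U * sin - U * cos) = fun _ => 0 := by
      funext y; simp [key y]
    rw [e] at h1
    have := h1.unique (hasDerivAt_const y 0)
    linear_combination this
  intro y
  by_cases hs : sin y = 0
  · have hc : cos y ≠ 0 := by
      intro hc
      have := sin_sq_add_cos_sq y
      simp [hs, hc] at this
    -- Zeros of `sin` are isolated, so the equation passes to them by continuity.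
    have hev : ∀ᶠ x in 𝓝[≠] y, deriv (deriv U) x + U x = 0 := by
      filter_upwards [(hasDerivAt_sin y).eventually_ne (c := 0) hc] with x hx
      exact (mul_eq_zero.1 (hk x)).resolve_right hx
    have ht : Tendsto (fun x => deriv (deriv U) x + U x) (𝓝[≠] y)
        (𝓝 (deriv (deriv U) y + U y)) :=
      ((hdd'.add hd.continuous).tendsto y).mono_left nhdsWithin_le_nhds
    exact tendsto_nhds_unique (ht.congr' hev) tendsto_const_nhds
  · exact (mul_eq_zero.1 (hk y)).resolve_right hs

/-- Wirtinger's inequality for periodic functions whose values at some pair of antipodal points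
cancel. -/
lemma wirtinger_of_antipodal {W : ℝ → ℝ} (hW : ContDiff ℝ ∞ W)
    (hp : Function.Periodic W (2 * π)) {b : ℝ} (hb : W b + W (b + π) = 0) :
    0 ≤ trigForm W ∧ (trigForm W ≤ 0 → ∃ c d, ∀ y, W y = c * cos y + d * sin y) := by
  have hV : ContDiff ℝ ∞ (fun y => W (y + b)) := hW.comp (contDiff_id.add contDiff_const)
  have hVp : Function.Periodic (fun y => W (y + b)) (2 * π) := fun y => by
    simp only [add_right_comm y (2 * π) b, hp (y + b)]
  -- The cosine term removes the value `W b` at 0 and `-W b` at π, creating the two zeros.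
  have hU : ContDiff ℝ ∞ (fun y => W (y + b) - (W b * cos y + 0 * sin y)) := by fun_prop
  have hUp : Function.Periodic (fun y => W (y + b) - (W b * cos y + 0 * sin y)) (2 * π) := fun y => by
    simp only [cos_add_two_pi, sin_add_two_pi]
    rw [show W (y + 2 * π + b) = W (y + b) from hVp y]
  obtain ⟨h1, h2⟩ := wirtinger_of_zero_of_zero hU hUp (by simp)
    (by simp only [cos_pi, sin_pi]; rw [add_comm π b]; linarith)
  rw [trigForm_sub_trig hV hVp, trigForm_comp_add hp] at h1 h2
  refine ⟨h1, fun h => ?_⟩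
  have h3 := h2 h
  set d := deriv (fun y => W (y + b) - (W b * cos y + 0 * sin y)) 0
  refine ⟨W b * cos b - d * sin b, W b * sin b + d * cos b, fun y => ?_⟩
  have := h3 (y - b)
  simp only [sub_add_cancel, zero_add, cos_zero, sin_zero] at this
  rw [cos_sub, sin_sub] at this
  linear_combination this

/-! ### Circle diffeomorphisms, balance and antipodal cancellation. -/

/-- A smooth lift to `ℝ` of an orientation preserving diffeomorphism of the circle `ℝ / 2πℤ`. -/
structure IsCircleLift (g : ℝ → ℝ) : Prop where
  smooth : ContDiff ℝ ∞ g
  deriv_pos : ∀ y, 0 < deriv g y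
  add_two_pi : ∀ y, g (y + 2 * π) = g y + 2 * π

namespace IsCircleLift

variable {g : ℝ → ℝ}

lemma add_const (hg : IsCircleLift g) (c : ℝ) : IsCircleLift (fun y => g y + c) where
  smooth := hg.smooth.add contDiff_const
  deriv_pos y := by simpa using hg.deriv_pos y
  add_two_pi y := by rw [hg.add_two_pi]; ring

lemma comp_add_const (hg : IsCircleLift g) (c : ℝ) : IsCircleLift (fun y => g (y + c)) where
  smooth := hg.smooth.comp (contDiff_id.add contDiff_const)
  deriv_pos y := by rw [deriv_comp_add_const]; exact hg.deriv_pos _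
  add_two_pi y := by rw [add_right_comm, hg.add_two_pi]

lemma differentiable (hg : IsCircleLift g) : Differentiable ℝ g :=
  hg.smooth.differentiable (by simp)

lemma continuous (hg : IsCircleLift g) : Continuous g := hg.smooth.continuous

lemma strictMono (hg : IsCircleLift g) : StrictMono g := strictMono_of_deriv_pos hg.deriv_pos

lemma smooth_deriv (hg : IsCircleLift g) : ContDiff ℝ ∞ (deriv g) :=
  (contDiff_infty_iff_deriv.1 hg.smooth).2

lemma deriv_add_two_pi (hg : IsCircleLift g) (y : ℝ) : deriv g (y + 2 * π) = deriv g y := by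
  rw [← deriv_comp_add_const]
  have : (fun y => g (y + 2 * π)) = fun y => g y + 2 * π := funext hg.add_two_pi
  rw [this]; simp

end IsCircleLift

/-- A circle diffeomorphism is unbalanced if, for some `p` with `g (p + π) = g p + π`, it
turns strictly less than its antipodal conjugate all along `(p, p + π)`. -/
def IsUnbalanced (g : ℝ → ℝ) : Prop :=
  ∃ p, g (p + π) = g p + π ∧ ∀ y ∈ Ioo p (p + π), g y < g (y + π) - π

/-- `cos g / √g'`, the pullback of `cos` as a density of weight `-1/2`. -/
noncomputable def halfDensityCos (g : ℝ → ℝ) (y : ℝ) : ℝ := cos (g y) / √(deriv g y)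

/-- Each term is the inverse square of a `halfDensityCos`, so comparing half densities compares the
growth of the tangents. -/
lemma hasDerivAt_tan_sub_tan {g h : ℝ → ℝ} (hg : Differentiable ℝ g) (hh : Differentiable ℝ h)
    {y : ℝ} (cg : cos (g y) ≠ 0) (ch : cos (h y) ≠ 0) :
    HasDerivAt (fun y => tan (h y) - tan (g y))
      (deriv h y / cos (h y) ^ 2 - deriv g y / cos (g y) ^ 2) y := by
  have h1 := (hasDerivAt_tan ch).comp y (hh y).hasDerivAt
  have h2 := (hasDerivAt_tan cg).comp y (hg y).hasDerivAt
  refine (h1.sub h2).congr_deriv ?_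
  ring

lemma div_sq_lt_div_sq_of_halfDensity_lt {p q c d : ℝ} (hp : 0 < p) (hq : 0 < q) (hd : 0 < d)
    (h : d / √q < c / √p) : p / c ^ 2 < q / d ^ 2 := by
  have h0 : 0 < d / √q := by positivity
  have hc : 0 < c := by
    by_contra hc
    have : c / √p ≤ 0 := div_nonpos_of_nonpos_of_nonneg (not_lt.1 hc) (sqrt_nonneg _)
    linarith
  have h2 : (d / √q) ^ 2 < (c / √p) ^ 2 := by gcongr
  rw [div_pow, div_pow, sq_sqrt hq.le, sq_sqrt hp.le] at h2
  rw [div_lt_div_iff₀ (by positivity) (by positivity)] at h2 ⊢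
  linarith

/-- While both cosines are positive, tan h - tan g increases from 0 at `p`. Once both are negative,
the comparison of squares reverses and tan h - tan g decreases to 0 at p + π. In between, `h` has
already crossed π/2 and `g` has not. -/
lemma angle_lt_of_halfDensity_lt {g h : ℝ → ℝ} (hg : Differentiable ℝ g)
    (hh : Differentiable ℝ h) (hg' : ∀ y, 0 < deriv g y) (hh' : ∀ y, 0 < deriv h y)
    {p : ℝ} (hp : h p = g p) (hp1 : h (p + π) = g p + π) (hp2 : g (p + π) = g p + π)
    (hl : -(π / 2) < g p) (hr : g p < π / 2)
    (hlt : ∀ y, halfDensityCos h y < halfDensityCos g y) :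
    ∀ y ∈ Ioo p (p + π), g y < h y := by
  have mg : StrictMono g := strictMono_of_deriv_pos hg'
  have mh : StrictMono h := strictMono_of_deriv_pos hh'
  have hpi := pi_pos
  obtain ⟨q, hq, eq⟩ : π / 2 ∈ g '' Icc p (p + π) :=
    intermediate_value_Icc (by linarith) hg.continuous.continuousOn
      ⟨hr.le, by rw [hp2]; linarith⟩
  obtain ⟨q', hq', eq'⟩ : π / 2 ∈ h '' Icc p (p + π) :=
    intermediate_value_Icc (by linarith) hh.continuous.continuousOn
      ⟨by rw [hp]; exact hr.le, by rw [hp1]; linarith⟩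
  -- At `q` the half density of `g` is 0, so that of `h` is negative there.
  have hqq : π / 2 < h q := by
    by_contra hc
    have h1 := hlt q
    have h2 : 0 ≤ cos (h q) := cos_nonneg_of_mem_Icc
      ⟨by have := mh.monotone hq.1; rw [hp] at this; linarith, not_lt.1 hc⟩
    unfold halfDensityCos at h1
    rw [eq, cos_pi_div_two, zero_div] at h1
    have : 0 ≤ cos (h q) / √(deriv h q) := by positivity
    linarith
  have hq'q : q' < q := by rw [← mh.lt_iff_lt, eq']; exact hqq
  have left : ∀ y ∈ Ioo p q', g y < h y := by
    have cosh_pos : ∀ y ∈ Ico p q', 0 < cos (h y) := fun y hy =>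
      cos_pos_of_mem_Ioo ⟨by have := mh.monotone hy.1; rw [hp] at this; linarith,
        by rw [← eq']; exact mh hy.2⟩
    have cosg_pos : ∀ y ∈ Ico p q', 0 < cos (g y) := fun y hy =>
      cos_pos_of_mem_Ioo ⟨by have := mg.monotone hy.1; linarith,
        by rw [← eq]; exact mg (hy.2.trans hq'q)⟩
    intro y hy
    have hd : ∀ x ∈ Icc p y, HasDerivAt (fun y => tan (h y) - tan (g y))
        (deriv h x / cos (h x) ^ 2 - deriv g x / cos (g x) ^ 2) x := fun x hx =>
      hasDerivAt_tan_sub_tan hg hh (cosg_pos x ⟨hx.1, hx.2.trans_lt hy.2⟩).ne'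
        (cosh_pos x ⟨hx.1, hx.2.trans_lt hy.2⟩).ne'
    have hm : StrictMonoOn (fun y => tan (h y) - tan (g y)) (Icc p y) := by
      refine strictMonoOn_of_deriv_pos (convex_Icc _ _)
        (fun x hx => (hd x hx).continuousAt.continuousWithinAt) ?_
      rw [interior_Icc]
      intro x hx
      rw [(hd x (Ioo_subset_Icc_self hx)).deriv, sub_pos]
      exact div_sq_lt_div_sq_of_halfDensity_lt (hg' x) (hh' x)
        (cosh_pos x ⟨hx.1.le, hx.2.trans hy.2⟩) (hlt x)
    have := hm (left_mem_Icc.2 hy.1.le) (right_mem_Icc.2 hy.1.le) hy.1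
    simp only [hp, sub_self, sub_pos] at this
    by_contra hc
    rcases eq_or_lt_of_le (not_lt.1 hc) with e | hc
    · rw [e] at this; exact lt_irrefl _ this
    have := tan_lt_tan_of_lt_of_lt_pi_div_two
      (by have := mh hy.1; rw [hp] at this; linarith)
      (by rw [← eq]; exact mg (hy.2.trans hq'q)) hc
    linarith
  have right : ∀ y ∈ Ioo q (p + π), g y < h y := by
    have cosh_neg : ∀ y ∈ Ioc q (p + π), cos (h y) < 0 := fun y hy =>
      cos_neg_of_pi_div_two_lt_of_lt (by rw [← eq']; exact mh (hq'q.trans hy.1))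
        (by have := mh.monotone hy.2; rw [hp1] at this; linarith)
    have cosg_neg : ∀ y ∈ Ioc q (p + π), cos (g y) < 0 := fun y hy =>
      cos_neg_of_pi_div_two_lt_of_lt (by rw [← eq]; exact mg hy.1)
        (by have := mg.monotone hy.2; rw [hp2] at this; linarith)
    intro y hy
    have hd : ∀ x ∈ Icc y (p + π), HasDerivAt (fun y => tan (h y) - tan (g y))
        (deriv h x / cos (h x) ^ 2 - deriv g x / cos (g x) ^ 2) x := fun x hx =>
      hasDerivAt_tan_sub_tan hg hh (cosg_neg x ⟨hy.1.trans_le hx.1, hx.2⟩).ne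
        (cosh_neg x ⟨hy.1.trans_le hx.1, hx.2⟩).ne
    have hm : StrictAntiOn (fun y => tan (h y) - tan (g y)) (Icc y (p + π)) := by
      refine strictAntiOn_of_deriv_neg (convex_Icc _ _)
        (fun x hx => (hd x hx).continuousAt.continuousWithinAt) ?_
      rw [interior_Icc]
      intro x hx
      rw [(hd x (Ioo_subset_Icc_self hx)).deriv, sub_neg, ← neg_sq (cos (h x)),
        ← neg_sq (cos (g x))]
      refine div_sq_lt_div_sq_of_halfDensity_lt (hh' x) (hg' x)
        (neg_pos.2 (cosg_neg x ⟨hy.1.trans hx.1, hx.2.le⟩)) ?_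
      rw [neg_div, neg_div, neg_lt_neg_iff]
      exact hlt x
    have := hm (left_mem_Icc.2 hy.2.le) (right_mem_Icc.2 hy.2.le) hy.2
    simp only [hp1, hp2, sub_self, sub_pos] at this
    by_contra hc
    rcases eq_or_lt_of_le (not_lt.1 hc) with e | hc
    · rw [e] at this; exact lt_irrefl _ this
    have := tan_lt_tan_of_lt_of_lt_pi_div_two (x := h y - π) (y := g y - π)
      (by have := mh (hq'q.trans hy.1); linarith)
      (by have := mg hy.2; linarith) (by linarith)
    rw [tan_sub_pi, tan_sub_pi] at this
    linarith
  intro y hy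
  rcases lt_or_ge y q' with h1 | h1
  · exact left y ⟨hy.1, h1⟩
  rcases lt_or_ge q y with h2 | h2
  · exact right y ⟨h2, hy.2⟩
  have a1 := mh.monotone h1
  have a2 := mg.monotone h2
  rw [eq'] at a1
  rw [eq] at a2
  rcases eq_or_lt_of_le h2 with e | h2
  · rw [e, eq]; exact hqq
  · have := mg h2; linarith

namespace IsCircleLift

variable {g : ℝ → ℝ}

lemma exists_antipodal (hg : IsCircleLift g) : ∃ p, g (p + π) = g p + π := by
  have hc : Continuous fun y => g (y + π) - g y - π := by
    have := hg.continuous; fun_prop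
  have h : g (π + π) - g π - π = -(g (0 + π) - g 0 - π) := by
    have := hg.add_two_pi 0
    simp only [zero_add] at this ⊢
    rw [← two_mul, this]; ring
  obtain ⟨p, -, hp⟩ : (0 : ℝ) ∈ (fun y => g (y + π) - g y - π) '' uIcc 0 π := by
    refine intermediate_value_uIcc hc.continuousOn ?_
    simp only [h, mem_uIcc]
    rcases le_total 0 (g (0 + π) - g 0 - π) with h | h
    · exact Or.inr ⟨by linarith, h⟩
    · exact Or.inl ⟨h, by linarith⟩
  exact ⟨p, by simp only at hp; linarith⟩

/-- The half density of g(y + π) - π is minus the translate of that of g, so the hypothesis says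
that the antipodal conjugate has the smaller half density everywhere. -/
lemma isUnbalanced_of_pos (hg : IsCircleLift g)
    (h : ∀ y, 0 < halfDensityCos g y + halfDensityCos g (y + π)) : IsUnbalanced g := by
  have hlt : ∀ y, halfDensityCos (fun y => g (y + π) - π) y < halfDensityCos g y := by
    intro y
    have := h y
    unfold halfDensityCos at this ⊢
    rw [cos_sub_pi, neg_div]
    rw [deriv_sub_const, deriv_comp_add_const]
    linarith
  obtain ⟨p, hp, hcp⟩ : ∃ p, g (p + π) = g p + π ∧ 0 < cos (g p) := by
    obtain ⟨p, hp⟩ := hg.exists_antipodal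
    have hne : cos (g p) ≠ 0 := by
      intro h0
      have := h p
      unfold halfDensityCos at this
      rw [hp, cos_add_pi, h0] at this
      simp at this
    rcases lt_or_gt_of_ne hne with h1 | h1
    -- Moving to the antipode flips the sign of cos (g p).
    · refine ⟨p + π, ?_, ?_⟩
      · rw [add_assoc, ← two_mul, hg.add_two_pi, hp]; ring
      · rw [hp, cos_add_pi]; linarith
    · exact ⟨p, hp, h1⟩
  refine ⟨p, hp, ?_⟩
  -- Subtracting 2πk places g p in (-π/2, π/2), as the comparison lemma requires.
  obtain ⟨k, hk⟩ : ∃ k : ℤ, -π < g p - k * (2 * π) ∧ g p - k * (2 * π) ≤ π := by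
    refine ⟨toIocDiv two_pi_pos (-π) (g p), ?_⟩
    have := sub_toIocDiv_zsmul_mem_Ioc two_pi_pos (-π) (g p)
    rw [zsmul_eq_mul] at this
    exact ⟨this.1, by linarith [this.2]⟩
  have hck : cos (g p - k * (2 * π)) = cos (g p) := cos_sub_int_mul_two_pi _ _
  have hl : -(π / 2) < g p - k * (2 * π) := by
    by_contra hc
    have := cos_nonpos_of_pi_div_two_le_of_le (x := -(g p - k * (2 * π))) (by linarith)
      (by linarith [pi_pos])
    rw [cos_neg, hck] at this; linarith
  have hr : g p - k * (2 * π) < π / 2 := by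
    by_contra hc
    have := cos_nonpos_of_pi_div_two_le_of_le (x := (g p - k * (2 * π))) (by linarith)
      (by linarith [pi_pos])
    rw [hck] at this; linarith
  have hG := hg.add_const (-(k * (2 * π)))
  have hH := (hg.comp_add_const π).add_const (-π - k * (2 * π))
  have := angle_lt_of_halfDensity_lt hG.differentiable hH.differentiable hG.deriv_pos hH.deriv_pos
    (p := p) (by linarith) (by rw [add_assoc, ← two_mul, hg.add_two_pi]; ring) (by rw [hp]; ring)
    (by linarith) (by linarith) (fun y => by
      have := hlt y
      unfold halfDensityCos at this ⊢
      simp only [deriv_add_const, deriv_sub_const] at this ⊢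
      rw [show g (y + π) + (-π - k * (2 * π)) = g (y + π) - π - k * (2 * π) by ring,
        ← sub_eq_add_neg, cos_sub_int_mul_two_pi, cos_sub_int_mul_two_pi]
      exact this)
  intro y hy
  have := this y hy
  linarith

lemma contDiff_halfDensityCos (hg : IsCircleLift g) : ContDiff ℝ ∞ (halfDensityCos g) := by
  unfold halfDensityCos
  exact (contDiff_cos.comp hg.smooth).div (hg.smooth_deriv.sqrt fun y => (hg.deriv_pos y).ne')
    fun y => (sqrt_pos.2 (hg.deriv_pos y)).ne'

lemma periodic_halfDensityCos (hg : IsCircleLift g) :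
    Function.Periodic (halfDensityCos g) (2 * π) := fun y => by
  unfold halfDensityCos
  rw [hg.add_two_pi, hg.deriv_add_two_pi, cos_add_two_pi]

lemma isUnbalanced_add_const {c : ℝ} : IsUnbalanced (fun y => g y + c) ↔ IsUnbalanced g := by
  unfold IsUnbalanced
  refine exists_congr fun p => and_congr ?_ (forall₂_congr fun y _ => ?_)
  · constructor <;> intro h <;> linarith
  · constructor <;> intro h <;> linarith

lemma exists_halfDensityCos_antipodal (hg : IsCircleLift g) (hb : ¬ IsUnbalanced g) :
    ∃ y, halfDensityCos g y + halfDensityCos g (y + π) = 0 := by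
  by_contra! hne
  have hc : Continuous fun y => halfDensityCos g y + halfDensityCos g (y + π) := by
    have := hg.contDiff_halfDensityCos.continuous; fun_prop
  have hsign : (∀ y, 0 < halfDensityCos g y + halfDensityCos g (y + π)) ∨
      ∀ y, halfDensityCos g y + halfDensityCos g (y + π) < 0 := by
    by_contra! hcon
    obtain ⟨⟨a, ha⟩, ⟨b, hb⟩⟩ := hcon
    obtain ⟨z, hz⟩ := mem_range_of_exists_le_of_exists_ge hc ⟨a, ha⟩ ⟨b, hb⟩
    exact hne z hz
  rcases hsign with h | h
  · exact hb (hg.isUnbalanced_of_pos h)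
  -- Adding π to `g` changes the sign of its half density.
  · refine hb (isUnbalanced_add_const.1 ((hg.add_const π).isUnbalanced_of_pos fun y => ?_))
    have := h y
    unfold halfDensityCos at this ⊢
    simp only [deriv_add_const, cos_add_pi, neg_div]
    linarith

lemma trigForm_halfDensityCos (hg : IsCircleLift g) (hb : ¬ IsUnbalanced g) :
    0 ≤ trigForm (halfDensityCos g) ∧ (trigForm (halfDensityCos g) ≤ 0 →
      ∃ c d, ∀ y, halfDensityCos g y = c * cos y + d * sin y) := by
  obtain ⟨y, hy⟩ := hg.exists_halfDensityCos_antipodal hb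
  exact wirtinger_of_antipodal hg.contDiff_halfDensityCos hg.periodic_halfDensityCos hy

/-- Folding the period in half gives ∫ cos(g - g p) - cos(h - g p) over (p, p + π), with h = g(· +
π) - π. Unbalance puts g below h with both differences in [0, π], where cosine decreases, so this is
positive. -/
lemma not_isUnbalanced_of_integral_cos_sin_comp (hg : IsCircleLift g)
    (hc : ∫ y in (0 : ℝ)..(2 * π), cos (g y) = 0)
    (hs : ∫ y in (0 : ℝ)..(2 * π), sin (g y) = 0) : ¬ IsUnbalanced g := by
  rintro ⟨p, hp, h⟩
  have hgc := hg.continuous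
  have hper : Function.Periodic (fun y => cos (g y - g p)) (2 * π) := fun y => by
    simp only [hg.add_two_pi, add_sub_right_comm, cos_add_two_pi]
  have h0 : ∫ y in p..(p + 2 * π), cos (g y - g p) = 0 := by
    rw [hper.intervalIntegral_add_eq p 0, zero_add]
    simp_rw [cos_sub]
    rw [intervalIntegral.integral_add, intervalIntegral.integral_mul_const,
      intervalIntegral.integral_mul_const, hc, hs]
    · simp
    all_goals exact Continuous.intervalIntegrable (by fun_prop) _ _
  have hi : ∀ a b, IntervalIntegrable (fun y => cos (g y - g p)) MeasureTheory.volume a b :=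
    fun a b => Continuous.intervalIntegrable (by fun_prop) _ _
  have hi' : ∀ a b, IntervalIntegrable (fun y => cos (g (y + π) - g p)) MeasureTheory.volume a b :=
    fun a b => Continuous.intervalIntegrable (by fun_prop) _ _
  rw [← intervalIntegral.integral_add_adjacent_intervals (b := p + π) (hi _ _) (hi _ _),
    show p + 2 * π = p + π + π by ring,
    ← intervalIntegral.integral_comp_add_right (fun y => cos (g y - g p)) π,
    ← intervalIntegral.integral_add (hi _ _) (hi' _ _)] at h0
  have : 0 < ∫ y in p..(p + π), (cos (g y - g p) + cos (g (y + π) - g p)) := by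
    refine intervalIntegral.intervalIntegral_pos_of_pos_on ((hi _ _).add (hi' _ _)) (fun y hy => ?_)
      (by linarith [pi_pos])
    have h1 := h y hy
    have h2 := hg.strictMono hy.1
    have h3 := hg.strictMono (add_lt_add_left hy.2 π)
    rw [add_assoc, ← two_mul, hg.add_two_pi] at h3
    have := cos_lt_cos_of_nonneg_of_le_pi (x := g y - g p) (y := g (y + π) - π - g p)
      (by linarith) (by linarith) (by linarith)
    rw [sub_right_comm, cos_sub_pi] at this
    linarith
  linarith

/-- Folding the period and integrating by parts turns ∫ cos(y - p) g' into -∫ sin(y - p)(h - g) over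
(p, p + π), with h = g(· + π) - π; boundary terms vanish because h = g at both ends. Unbalance makes
this negative. -/
lemma not_isUnbalanced_of_integral_deriv_mul (hg : IsCircleLift g)
    (hc : ∫ y in (0 : ℝ)..(2 * π), cos y * deriv g y = 0)
    (hs : ∫ y in (0 : ℝ)..(2 * π), sin y * deriv g y = 0) : ¬ IsUnbalanced g := by
  rintro ⟨p, hp, h⟩
  have hgc := hg.continuous
  have hgc' := hg.smooth_deriv.continuous
  have hper : Function.Periodic (fun y => cos (y - p) * deriv g y) (2 * π) := fun y => by
    simp only [hg.deriv_add_two_pi, add_sub_right_comm, cos_add_two_pi]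
  have h0 : ∫ y in p..(p + 2 * π), cos (y - p) * deriv g y = 0 := by
    rw [hper.intervalIntegral_add_eq p 0, zero_add]
    simp_rw [cos_sub]
    have e : ∀ y, (cos y * cos p + sin y * sin p) * deriv g y
      = cos y * deriv g y * cos p + sin y * deriv g y * sin p := fun y => by ring
    simp_rw [e]
    rw [intervalIntegral.integral_add, intervalIntegral.integral_mul_const,
      intervalIntegral.integral_mul_const, hc, hs]
    · simp
    all_goals exact Continuous.intervalIntegrable (by fun_prop) _ _
  have hi : ∀ a b, IntervalIntegrable (fun y => cos (y - p) * deriv g y)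
      MeasureTheory.volume a b :=
    fun a b => Continuous.intervalIntegrable (by fun_prop) _ _
  have hi' : ∀ a b, IntervalIntegrable (fun y => cos (y + π - p) * deriv g (y + π))
      MeasureTheory.volume a b :=
    fun a b => Continuous.intervalIntegrable (by fun_prop) _ _
  rw [← intervalIntegral.integral_add_adjacent_intervals (b := p + π) (hi _ _) (hi _ _),
    show p + 2 * π = p + π + π by ring,
    ← intervalIntegral.integral_comp_add_right (fun y => cos (y - p) * deriv g y) π,
    ← intervalIntegral.integral_add (hi _ _) (hi' _ _)] at h0
  have hder : ∀ y ∈ uIcc p (p + π), HasDerivAt (fun y => cos (y - p) * (g (y + π) - π - g y))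
      (-(sin (y - p) * (g (y + π) - π - g y)) -
        (cos (y - p) * deriv g y + cos (y + π - p) * deriv g (y + π))) y := by
    intro y _
    have h1 : HasDerivAt (fun y => cos (y - p)) (-sin (y - p)) y := by
      simpa using (hasDerivAt_cos (y - p)).comp_sub_const y p
    have h2 : HasDerivAt (fun y => g (y + π)) (deriv g (y + π)) y :=
      (hg.differentiable (y + π)).hasDerivAt.comp_add_const y π
    refine (h1.mul ((h2.sub_const π).sub (hg.differentiable y).hasDerivAt)).congr_deriv ?_
    rw [add_sub_right_comm, cos_add_pi]
    simp only [Pi.sub_apply]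
    ring
  have hftc := intervalIntegral.integral_eq_sub_of_hasDerivAt hder
    (Continuous.intervalIntegrable (by fun_prop) _ _)
  rw [intervalIntegral.integral_sub (Continuous.intervalIntegrable (by fun_prop) _ _)
    ((hi _ _).add (hi' _ _)), h0, intervalIntegral.integral_neg] at hftc
  have hz : g (p + π + π) = g p + 2 * π := by rw [add_assoc, ← two_mul, hg.add_two_pi]
  simp only [hz, hp] at hftc
  have : 0 < ∫ y in p..(p + π), sin (y - p) * (g (y + π) - π - g y) := by
    refine intervalIntegral.intervalIntegral_pos_of_pos_on
      (Continuous.intervalIntegrable (by fun_prop) _ _) (fun y hy => ?_) (by linarith [pi_pos])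
    exact mul_pos (sin_pos_of_pos_of_lt_pi (by linarith [hy.1]) (by linarith [hy.2]))
      (sub_pos.2 (h y hy))
  have hz' : (g p + 2 * π - π - (g p + π)) = 0 := by ring
  rw [hz', sub_self, mul_zero, add_sub_cancel_right, sub_self] at hftc
  linarith

end IsCircleLift

/-! ### The energy as a sum of two Wirtinger forms. -/

/-- `∫ g''² / (4 g'³) - 1 / g' + 2π`, the parameter-free form of both energies. -/
noncomputable def liftEnergy (g : ℝ → ℝ) : ℝ :=
  (∫ y in (0 : ℝ)..(2 * π), (deriv (deriv g) y ^ 2 / (4 * deriv g y ^ 3) - 1 / deriv g y)) + 2 * π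

namespace IsCircleLift

variable {g : ℝ → ℝ}

lemma hasDerivAt_halfDensityCos (hg : IsCircleLift g) (y : ℝ) :
    HasDerivAt (halfDensityCos g) (-sin (g y) * √(deriv g y)
      - cos (g y) * deriv (deriv g) y / (2 * (deriv g y * √(deriv g y)))) y := by
  have hp := hg.deriv_pos y
  have h1 := (hasDerivAt_cos (g y)).comp y (hg.differentiable y).hasDerivAt
  have h2 := ((hg.smooth_deriv.differentiable (by simp)) y).hasDerivAt.sqrt hp.ne'
  refine (h1.div h2 (sqrt_pos.2 hp).ne').congr_deriv ?_
  simp only [Function.comp]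
  have hs : √(deriv g y) ≠ 0 := (sqrt_pos.2 hp).ne'
  have e := sq_sqrt hp.le
  set r := √(deriv g y)
  rw [← e]
  field_simp

lemma halfDensityCos_sub_pi_div_two (y : ℝ) :
    halfDensityCos (fun y => g y + -(π / 2)) y = sin (g y) / √(deriv g y) := by
  unfold halfDensityCos
  simp only [← sub_eq_add_neg, deriv_sub_const, cos_sub_pi_div_two]

lemma continuous_deriv_halfDensityCos (hg : IsCircleLift g) :
    Continuous (deriv (halfDensityCos g)) :=
  hg.contDiff_halfDensityCos.continuous_deriv (by simp)

/-- In the sum of the two integrands the cross terms cancel and sin² + cos² = 1 leaves the energy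
density plus g', whose integral over a period is 2π. -/
lemma liftEnergy_eq (hg : IsCircleLift g) : liftEnergy g =
    trigForm (halfDensityCos g) + trigForm (halfDensityCos fun y => g y + -(π / 2)) := by
  have hs := hg.add_const (-(π / 2))
  have c1 := hg.contDiff_halfDensityCos.continuous
  have c2 := hs.contDiff_halfDensityCos.continuous
  have c3 := hg.continuous_deriv_halfDensityCos
  have c4 := hs.continuous_deriv_halfDensityCos
  have hdd : Continuous (deriv (deriv g)) := hg.smooth_deriv.continuous_deriv (by simp)
  have hd : Continuous (deriv g) := hg.smooth_deriv.continuous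
  have hne : ∀ y, deriv g y ≠ 0 := fun y => (hg.deriv_pos y).ne'
  unfold trigForm
  rw [← intervalIntegral.integral_add (Continuous.intervalIntegrable (by fun_prop) _ _)
    (Continuous.intervalIntegrable (by fun_prop) _ _)]
  have e : ∀ y, deriv (halfDensityCos g) y ^ 2 - halfDensityCos g y ^ 2 +
      (deriv (halfDensityCos fun y => g y + -(π / 2)) y ^ 2
        - halfDensityCos (fun y => g y + -(π / 2)) y ^ 2)
      = (deriv (deriv g) y ^ 2 / (4 * deriv g y ^ 3) - 1 / deriv g y) + deriv g y := by
    intro y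
    have hp := hg.deriv_pos y
    rw [(hg.hasDerivAt_halfDensityCos y).deriv, (hs.hasDerivAt_halfDensityCos y).deriv,
      halfDensityCos_sub_pi_div_two]
    unfold halfDensityCos
    rw [deriv_add_const', ← sub_eq_add_neg, cos_sub_pi_div_two, sin_sub_pi_div_two]
    have hs : √(deriv g y) ≠ 0 := (sqrt_pos.2 hp).ne'
    have e := sq_sqrt hp.le
    set r := √(deriv g y)
    rw [← e]
    have t := sin_sq_add_cos_sq (g y)
    have t' : cos (g y) ^ 2 = 1 - sin (g y) ^ 2 := by linarith
    field_simp
    ring_nf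
    rw [t']
    ring
  simp_rw [e]
  rw [intervalIntegral.integral_add _ (hd.intervalIntegrable _ _)]
  · rw [intervalIntegral.integral_deriv_eq_sub (fun y _ => hg.differentiable y)
      (hd.intervalIntegrable _ _)]
    have := hg.add_two_pi 0
    rw [zero_add] at this
    rw [this, add_sub_cancel_left]
    rfl
  · refine Continuous.intervalIntegrable (Continuous.sub (Continuous.div (by fun_prop)
      (by fun_prop) fun y => ?_) (Continuous.div (by fun_prop) (by fun_prop) hne)) _ _
    have := hg.deriv_pos y
    positivity

end IsCircleLift

/-! ### Möbius transformations and the equality case. -/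

/-- The angles `α t` and `β t` correspond under a fixed `SL(2, ℝ)` Möbius transformation of the
circle: `e^{iα}` is a positive multiple of `B e^{iβ}`. -/
def MoebiusRelated (α β : ℝ → ℝ) : Prop :=
  ∃ a b c d : ℝ, a * d - b * c = 1 ∧ ∀ t, ∃ r : ℝ, 0 < r ∧
    r * cos (α t) = a * cos (β t) + b * sin (β t) ∧
    r * sin (α t) = c * cos (β t) + d * sin (β t)

lemma MoebiusRelated.symm {α β : ℝ → ℝ} (h : MoebiusRelated α β) : MoebiusRelated β α := by
  obtain ⟨a, b, c, d, hdet, h⟩ := h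
  refine ⟨d, -b, -c, a, by linarith, fun t => ?_⟩
  obtain ⟨r, hr, h1, h2⟩ := h t
  refine ⟨r⁻¹, inv_pos.2 hr, ?_, ?_⟩
  · rw [inv_mul_eq_iff_eq_mul₀ hr.ne']
    linear_combination (-d) * h1 + b * h2 - cos (β t) * hdet
  · rw [inv_mul_eq_iff_eq_mul₀ hr.ne']
    linear_combination c * h1 - a * h2 - sin (β t) * hdet

lemma moebiusRelated_comp_iff {g β : ℝ → ℝ} (hβ : Function.Surjective β) :
    MoebiusRelated (g ∘ β) β ↔ MoebiusRelated g id := by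
  unfold MoebiusRelated
  refine exists_congr fun a => exists_congr fun b => exists_congr fun c => exists_congr fun d =>
    and_congr Iff.rfl ⟨fun h y => ?_, fun h t => h (β t)⟩
  obtain ⟨t, rfl⟩ := hβ y
  exact h t

lemma hasDerivAt_trig (a b y : ℝ) :
    HasDerivAt (fun y => a * cos y + b * sin y) (b * cos y - a * sin y) y :=
  (((hasDerivAt_cos y).const_mul a).add ((hasDerivAt_sin y).const_mul b)).congr_deriv (by ring)

namespace IsCircleLift

variable {g : ℝ → ℝ}

/-- A Möbius relation fixes the direction of the linear image; its scale r is forced to be 1/√g' by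
the determinant. Conversely, the determinant is the Wronskian of cos g / √g' and sin g / √g', which
is 1. -/
lemma moebiusRelated_iff (hg : IsCircleLift g) : MoebiusRelated g id ↔
    (∃ a b, ∀ y, halfDensityCos g y = a * cos y + b * sin y) ∧
    ∃ c d, ∀ y, halfDensityCos (fun y => g y + -(π / 2)) y = c * cos y + d * sin y := by
  constructor
  · rintro ⟨a, b, c, d, hdet, h⟩
    have key : ∀ y, cos (g y) / √(deriv g y) = a * cos y + b * sin y ∧
        sin (g y) / √(deriv g y) = c * cos y + d * sin y := by
      intro y
      have hd := (hg.differentiable y).hasDerivAt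
      have h0 : HasDerivAt (fun y => (a * cos y + b * sin y) * sin (g y)
          - (c * cos y + d * sin y) * cos (g y)) _ y :=
        ((hasDerivAt_trig a b y).mul hd.sin).sub ((hasDerivAt_trig c d y).mul hd.cos)
      have e : (fun y => (a * cos y + b * sin y) * sin (g y)
          - (c * cos y + d * sin y) * cos (g y)) = fun _ => 0 := by
        funext y
        obtain ⟨r, hr, h1, h2⟩ := h y
        simp only [id] at h1 h2
        rw [← h1, ← h2]; ring
      rw [e] at h0
      have h3 := h0.unique (hasDerivAt_const y 0)
      obtain ⟨r, hr, h1, h2⟩ := h y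
      simp only [id] at h1 h2
      -- Multiplying the differentiated parallelism relation by r gives r² g' = ad - bc.
      have h4 : r ^ 2 * deriv g y = 1 := by
        rw [← h1, ← h2] at h3
        have t1 := sin_sq_add_cos_sq (g y)
        have t2 := sin_sq_add_cos_sq y
        linear_combination r * h3 - r ^ 2 * deriv g y * t1
          - (b * cos y - a * sin y) * h2 + (d * cos y - c * sin y) * h1 + hdet
          + (a * d - b * c) * t2
      have h5 : r = 1 / √(deriv g y) := by
        have hp := hg.deriv_pos y
        rw [eq_div_iff (sqrt_pos.2 hp).ne', ← sq_eq_sq₀ (by positivity) (by positivity), mul_pow,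
          sq_sqrt hp.le, h4, one_pow]
      rw [← h1, ← h2, h5]
      constructor <;> ring
    exact ⟨⟨a, b, fun y => (key y).1⟩, c, d, fun y => by
      rw [halfDensityCos_sub_pi_div_two]; exact (key y).2⟩
  · rintro ⟨⟨a, b, h1⟩, c, d, h2⟩
    have hs := hg.add_const (-(π / 2))
    refine ⟨a, b, c, d, ?_, fun y => ⟨1 / √(deriv g y), ?_, ?_, ?_⟩⟩
    · have e1 : halfDensityCos g = fun y => a * cos y + b * sin y := funext h1
      have e2 : (halfDensityCos fun y => g y + -(π / 2)) = fun y => c * cos y + d * sin y :=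
        funext h2
      have d1 := hg.hasDerivAt_halfDensityCos 0
      have d2 := hs.hasDerivAt_halfDensityCos 0
      rw [e1] at d1
      rw [e2] at d2
      have u1 := d1.unique (hasDerivAt_trig a b 0)
      have u2 := d2.unique (hasDerivAt_trig c d 0)
      have v1 := h1 0
      have v2 := h2 0
      rw [halfDensityCos_sub_pi_div_two] at v2
      unfold halfDensityCos at v1
      rw [deriv_add_const', ← sub_eq_add_neg, cos_sub_pi_div_two, sin_sub_pi_div_two] at u2
      simp only [cos_zero, sin_zero, mul_one, mul_zero, add_zero, sub_zero] at u1 u2 v1 v2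
      rw [← u1, ← u2, ← v1, ← v2]
      have hp := hg.deriv_pos 0
      have hs : √(deriv g 0) ≠ 0 := (sqrt_pos.2 hp).ne'
      have t := sin_sq_add_cos_sq (g 0)
      field_simp
      linear_combination 2 * √(deriv g 0) ^ 2 * deriv g 0 * t
    · have := sqrt_pos.2 (hg.deriv_pos y); positivity
    · rw [id, ← h1 y]; unfold halfDensityCos; ring
    · rw [id, ← h2 y, halfDensityCos_sub_pi_div_two]; ring

theorem liftEnergy_nonneg (hg : IsCircleLift g) (hb : ¬ IsUnbalanced g) : 0 ≤ liftEnergy g := by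
  have hs := hg.add_const (-(π / 2))
  have h1 := (hg.trigForm_halfDensityCos hb).1
  have h2 := (hs.trigForm_halfDensityCos (isUnbalanced_add_const.not.2 hb)).1
  rw [hg.liftEnergy_eq]; exact add_nonneg h1 h2

theorem liftEnergy_eq_zero_iff (hg : IsCircleLift g) (hb : ¬ IsUnbalanced g) :
    liftEnergy g = 0 ↔ MoebiusRelated g id := by
  have hs := hg.add_const (-(π / 2))
  have h1 := hg.trigForm_halfDensityCos hb
  have h2 := hs.trigForm_halfDensityCos (isUnbalanced_add_const.not.2 hb)
  rw [hg.liftEnergy_eq, hg.moebiusRelated_iff]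
  constructor
  · intro h
    exact ⟨h1.2 (by linarith [h2.1]), h2.2 (by linarith [h1.1])⟩
  · rintro ⟨⟨a, b, e1⟩, c, d, e2⟩
    rw [funext e1, funext e2, trigForm_trig, trigForm_trig, add_zero]

end IsCircleLift

/-! ### Composition, inversion and change of variables. -/

namespace IsCircleLift

variable {g h : ℝ → ℝ}

lemma comp (hg : IsCircleLift g) (hh : IsCircleLift h) : IsCircleLift (g ∘ h) where
  smooth := hg.smooth.comp hh.smooth
  deriv_pos y := by
    rw [deriv_comp y (hg.differentiable _) (hh.differentiable y)]
    exact mul_pos (hg.deriv_pos _) (hh.deriv_pos y)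
  add_two_pi y := by simp only [Function.comp, hh.add_two_pi, hg.add_two_pi]

lemma of_inverse (hg : IsCircleLift g) (hh : ContDiff ℝ ∞ h)
    (hr : Function.RightInverse h g) : IsCircleLift h where
  smooth := hh
  deriv_pos y := by
    have h1 := (hg.differentiable (h y)).hasDerivAt.comp y
      ((hh.differentiable (by simp)) y).hasDerivAt
    have e : g ∘ h = id := funext hr
    rw [e] at h1
    have h2 := h1.unique (hasDerivAt_id y)
    have h3 := hg.deriv_pos (h y)
    by_contra hc
    have := mul_nonpos_of_nonneg_of_nonpos h3.le (not_lt.1 hc)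
    linarith
  add_two_pi y := by
    apply hg.strictMono.injective
    rw [hr, hg.add_two_pi, hr]

lemma surjective (hg : IsCircleLift g) : Function.Surjective g := by
  have hn : ∀ n : ℕ, g (n * (2 * π)) = g 0 + n * (2 * π) := by
    intro n
    induction n with
    | zero => simp
    | succ n ih => push_cast; rw [add_mul, one_mul, hg.add_two_pi, ih]; ring
  have hn' : ∀ n : ℕ, g (-(n * (2 * π))) = g 0 - n * (2 * π) := by
    intro n
    induction n with
    | zero => simp
    | succ n ih =>
      have := hg.add_two_pi (-((n + 1 : ℕ) * (2 * π)))
      rw [show -(((n + 1 : ℕ) : ℝ) * (2 * π)) + 2 * π = -(n * (2 * π)) by push_cast; ring, ih] at this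
      push_cast at this ⊢
      linarith
  intro y
  obtain ⟨n, h⟩ := exists_nat_ge (|y - g 0| / (2 * π))
  rw [div_le_iff₀ two_pi_pos] at h
  have := abs_le.1 h
  exact mem_range_of_exists_le_of_exists_ge hg.continuous
    ⟨-(n * (2 * π)), by rw [hn']; linarith⟩ ⟨n * (2 * π), by rw [hn]; linarith⟩

lemma exists_inverse (hg : IsCircleLift g) : ∃ h, IsCircleLift h ∧
    Function.LeftInverse h g ∧ Function.RightInverse h g := by
  let e : ℝ ≃ₜ ℝ := (hg.strictMono.orderIsoOfSurjective g hg.surjective).toHomeomorph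
  have he : ⇑e = g := rfl
  have hl : Function.LeftInverse e.symm g := e.symm_apply_apply
  have hr : Function.RightInverse e.symm g := e.apply_symm_apply
  refine ⟨e.symm, hg.of_inverse ?_ hr, hl, hr⟩
  exact e.contDiff_symm_deriv (f' := deriv g) (fun y => (hg.deriv_pos y).ne')
    (fun y => (hg.differentiable y).hasDerivAt) hg.smooth

lemma integral_comp_mul_deriv (hg : IsCircleLift g) {f : ℝ → ℝ} (hf : Continuous f)
    (hp : Function.Periodic f (2 * π)) :
    ∫ t in (0 : ℝ)..(2 * π), f (g t) * deriv g t = ∫ y in (0 : ℝ)..(2 * π), f y := by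
  have h1 := intervalIntegral.integral_comp_mul_deriv (a := 0) (b := 2 * π)
    (fun x _ => (hg.differentiable x).hasDerivAt) hg.smooth_deriv.continuous.continuousOn hf
  simp only [Function.comp] at h1
  rw [h1]
  have h2 := hg.add_two_pi 0
  rw [zero_add] at h2
  rw [h2, hp.intervalIntegral_add_eq (g 0) 0, zero_add]

lemma liftEnergy_eq_integral_comp (hg : IsCircleLift g) (hh : IsCircleLift h) :
    liftEnergy g = (∫ t in (0 : ℝ)..(2 * π),
      (deriv (deriv g) (h t) ^ 2 / (4 * deriv g (h t) ^ 3) - 1 / deriv g (h t)) * deriv h t)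
        + 2 * π := by
  have hdd : Continuous (deriv (deriv g)) := hg.smooth_deriv.continuous_deriv (by simp)
  have hd : Continuous (deriv g) := hg.smooth_deriv.continuous
  have hc : Continuous fun y => deriv (deriv g) y ^ 2 / (4 * deriv g y ^ 3) - 1 / deriv g y := by
    refine Continuous.sub (Continuous.div (by fun_prop) (by fun_prop) fun y => ?_)
      (Continuous.div (by fun_prop) (by fun_prop) fun y => (hg.deriv_pos y).ne')
    have := hg.deriv_pos y
    positivity
  rw [hh.integral_comp_mul_deriv hc]
  · rfl
  · intro y
    simp only [hg.deriv_add_two_pi, periodic_deriv (W := deriv g) hg.deriv_add_two_pi y]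

end IsCircleLift

/-! ### Arc length, tangent angle and curvature of the curve. -/

namespace SmoothClosedCurve

variable (σ : SmoothClosedCurve)

lemma contDiff_deriv : ContDiff ℝ ∞ (deriv σ.toFun) := (contDiff_infty_iff_deriv.1 σ.smooth).2

lemma speed_pos (t : ℝ) : 0 < σ.speed t := norm_pos_iff.2 (σ.immersion t)

lemma contDiff_speed : ContDiff ℝ ∞ σ.speed := σ.contDiff_deriv.norm ℝ σ.immersion

lemma continuous_speed : Continuous σ.speed := σ.contDiff_speed.continuous

lemma periodic_speed : Function.Periodic σ.speed (2 * π) := fun t => by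
  unfold speed
  rw [← deriv_comp_add_const, show (fun x => σ.toFun (x + 2 * π)) = σ.toFun from
    funext σ.periodic]

lemma hasDerivAt_arcLength (t : ℝ) : HasDerivAt σ.arcLength (σ.speed t) t :=
  (σ.continuous_speed.integral_hasStrictDerivAt 0 t).hasDerivAt

lemma length_pos : 0 < σ.length :=
  intervalIntegral.intervalIntegral_pos_of_pos_on (σ.continuous_speed.intervalIntegrable _ _)
    (fun t _ => σ.speed_pos t) two_pi_pos

/-- The arc length parameter rescaled to total length `2π`. -/
noncomputable def normalizedArcLength (t : ℝ) : ℝ := 2 * π * σ.arcLength t / σ.length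

lemma hasDerivAt_normalizedArcLength (t : ℝ) :
    HasDerivAt σ.normalizedArcLength (2 * π / σ.length * σ.speed t) t :=
  (((σ.hasDerivAt_arcLength t).const_mul (2 * π)).div_const σ.length).congr_deriv (by ring)

lemma deriv_normalizedArcLength (t : ℝ) :
    deriv σ.normalizedArcLength t = 2 * π / σ.length * σ.speed t :=
  (σ.hasDerivAt_normalizedArcLength t).deriv

lemma isCircleLift_normalizedArcLength : IsCircleLift σ.normalizedArcLength where
  smooth := by
    refine contDiff_infty_iff_deriv.2
      ⟨fun t => (σ.hasDerivAt_normalizedArcLength t).differentiableAt, ?_⟩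
    rw [funext σ.deriv_normalizedArcLength]
    exact contDiff_const.mul σ.contDiff_speed
  deriv_pos t := by
    rw [deriv_normalizedArcLength]
    have := σ.speed_pos t
    have := σ.length_pos
    positivity
  add_two_pi t := by
    have h : σ.arcLength (t + 2 * π) = σ.arcLength t + σ.length := by
      have hi := fun a b => σ.continuous_speed.intervalIntegrable (μ := MeasureTheory.volume) a b
      unfold length arcLength
      rw [← intervalIntegral.integral_add_adjacent_intervals (hi 0 t) (hi t (t + 2 * π)),
        σ.periodic_speed.intervalIntegral_add_eq t 0, zero_add]
    unfold normalizedArcLength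
    rw [h]
    have := σ.length_pos
    field_simp

variable {σ} {ϑ : ℝ → ℝ}

lemma deriv_apply_zero (hT : ∀ t, σ.unitTangent t = !₂[cos (ϑ t), sin (ϑ t)]) (t : ℝ) :
    deriv σ.toFun t 0 = σ.speed t * cos (ϑ t) := by
  have := congrArg (fun p : Plane => p 0) (hT t)
  simp only [unitTangent, PiLp.smul_apply, smul_eq_mul] at this
  rw [inv_mul_eq_iff_eq_mul₀ (σ.speed_pos t).ne'] at this
  simpa using this

lemma deriv_apply_one (hT : ∀ t, σ.unitTangent t = !₂[cos (ϑ t), sin (ϑ t)]) (t : ℝ) :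
    deriv σ.toFun t 1 = σ.speed t * sin (ϑ t) := by
  have := congrArg (fun p : Plane => p 1) (hT t)
  simp only [unitTangent, PiLp.smul_apply, smul_eq_mul] at this
  rw [inv_mul_eq_iff_eq_mul₀ (σ.speed_pos t).ne'] at this
  simpa using this

lemma hasDerivAt_apply {f : ℝ → Plane} {f' : Plane} {t : ℝ} (h : HasDerivAt f f' t) (i : Fin 2) :
    HasDerivAt (fun t => f t i) (f' i) t :=
  (EuclideanSpace.proj (𝕜 := ℝ) i : Plane →L[ℝ] ℝ).hasFDerivAt.comp_hasDerivAt t h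

lemma curvature_eq (hϑ : Differentiable ℝ ϑ)
    (hT : ∀ t, σ.unitTangent t = !₂[cos (ϑ t), sin (ϑ t)]) (t : ℝ) :
    σ.curvature t = deriv ϑ t / σ.speed t := by
  have hdd := (σ.contDiff_deriv.differentiable (by simp) t).hasDerivAt
  have hs := (σ.contDiff_speed.differentiable (by simp) t).hasDerivAt
  have h0 := hasDerivAt_apply hdd 0
  have h1 := hasDerivAt_apply hdd 1
  rw [funext (deriv_apply_zero hT)] at h0
  rw [funext (deriv_apply_one hT)] at h1
  have e0 := h0.unique (hs.mul (hϑ t).hasDerivAt.cos)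
  have e1 := h1.unique (hs.mul (hϑ t).hasDerivAt.sin)
  unfold curvature
  rw [e0, e1, deriv_apply_zero hT, deriv_apply_one hT]
  have := σ.speed_pos t
  have t1 := sin_sq_add_cos_sq (ϑ t)
  field_simp
  linear_combination σ.speed t * deriv ϑ t * t1

/-- This closing condition is what excludes unbalanced diffeomorphisms. -/
lemma integral_deriv_apply (i : Fin 2) :
    ∫ t in (0 : ℝ)..(2 * π), deriv σ.toFun t i = 0 := by
  have hd : ∀ t ∈ uIcc 0 (2 * π), HasDerivAt (fun t => σ.toFun t i) (deriv σ.toFun t i) t :=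
    fun t _ => hasDerivAt_apply (σ.smooth.differentiable (by simp) t).hasDerivAt i
  have hc : Continuous fun t => deriv σ.toFun t i :=
    (EuclideanSpace.proj (𝕜 := ℝ) i : Plane →L[ℝ] ℝ).continuous.comp
      σ.contDiff_deriv.continuous
  rw [intervalIntegral.integral_eq_sub_of_hasDerivAt hd (hc.intervalIntegrable _ _)]
  have := σ.periodic 0
  rw [zero_add] at this
  rw [this, sub_self]

lemma integral_cos_mul_deriv (hT : ∀ t, σ.unitTangent t = !₂[cos (ϑ t), sin (ϑ t)]) :
    ∫ t in (0 : ℝ)..(2 * π), cos (ϑ t) * deriv σ.normalizedArcLength t = 0 := by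
  have e : ∀ t, cos (ϑ t) * deriv σ.normalizedArcLength t
      = 2 * π / σ.length * deriv σ.toFun t 0 := fun t => by
    rw [deriv_apply_zero hT, deriv_normalizedArcLength]; ring
  simp_rw [e]
  rw [intervalIntegral.integral_const_mul, integral_deriv_apply, mul_zero]

lemma integral_sin_mul_deriv (hT : ∀ t, σ.unitTangent t = !₂[cos (ϑ t), sin (ϑ t)]) :
    ∫ t in (0 : ℝ)..(2 * π), sin (ϑ t) * deriv σ.normalizedArcLength t = 0 := by
  have e : ∀ t, sin (ϑ t) * deriv σ.normalizedArcLength t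
      = 2 * π / σ.length * deriv σ.toFun t 1 := fun t => by
    rw [deriv_apply_one hT, deriv_normalizedArcLength]; ring
  simp_rw [e]
  rw [intervalIntegral.integral_const_mul, integral_deriv_apply, mul_zero]

lemma not_isUnbalanced_angle {g : ℝ → ℝ} (hg : IsCircleLift g)
    (hgϑ : ∀ t, g (σ.normalizedArcLength t) = ϑ t)
    (hT : ∀ t, σ.unitTangent t = !₂[cos (ϑ t), sin (ϑ t)]) : ¬ IsUnbalanced g := by
  have hl := σ.isCircleLift_normalizedArcLength
  have hc := hg.continuous
  refine hg.not_isUnbalanced_of_integral_cos_sin_comp ?_ ?_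
  · rw [← hl.integral_comp_mul_deriv (by fun_prop) fun y => by
      rw [hg.add_two_pi, cos_add_two_pi]]
    simp_rw [hgϑ]
    exact integral_cos_mul_deriv hT
  · rw [← hl.integral_comp_mul_deriv (by fun_prop) fun y => by
      rw [hg.add_two_pi, sin_add_two_pi]]
    simp_rw [hgϑ]
    exact integral_sin_mul_deriv hT

lemma deriv_comp_mul_deriv {g α β : ℝ → ℝ} (hg : IsCircleLift g) (hα : IsCircleLift α)
    (h : ∀ t, g (α t) = β t) (t : ℝ) : deriv g (α t) * deriv α t = deriv β t := by
  rw [← funext h]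
  exact (deriv_comp t (hg.differentiable _) (hα.differentiable t)).symm

lemma not_isUnbalanced_arcLength {g : ℝ → ℝ} (hg : IsCircleLift g) (hϑ : IsCircleLift ϑ)
    (hgϑ : ∀ t, g (ϑ t) = σ.normalizedArcLength t)
    (hT : ∀ t, σ.unitTangent t = !₂[cos (ϑ t), sin (ϑ t)]) : ¬ IsUnbalanced g := by
  have hc := hg.smooth_deriv.continuous
  have hd := deriv_comp_mul_deriv hg hϑ hgϑ
  refine hg.not_isUnbalanced_of_integral_deriv_mul ?_ ?_
  · rw [← hϑ.integral_comp_mul_deriv (by fun_prop) fun y => by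
      rw [hg.deriv_add_two_pi, cos_add_two_pi]]
    simp_rw [mul_assoc, hd]
    exact integral_cos_mul_deriv hT
  · rw [← hϑ.integral_comp_mul_deriv (by fun_prop) fun y => by
      rw [hg.deriv_add_two_pi, sin_add_two_pi]]
    simp_rw [mul_assoc, hd]
    exact integral_sin_mul_deriv hT

/-- Here κ = (2π/L) g' at the normalized arc length, and the powers of 2π/L cancel. -/
lemma energyG_eq {g : ℝ → ℝ} (hg : IsCircleLift g) (hϑ : IsCircleLift ϑ)
    (hgϑ : ∀ t, g (σ.normalizedArcLength t) = ϑ t)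
    (hT : ∀ t, σ.unitTangent t = !₂[cos (ϑ t), sin (ϑ t)]) : σ.energyG = liftEnergy g := by
  have hl := σ.isCircleLift_normalizedArcLength
  rw [hg.liftEnergy_eq_integral_comp hl]
  unfold energyG integral
  congr 1
  refine intervalIntegral.integral_congr fun t _ => ?_
  have hL := σ.length_pos
  have hκ : σ.curvature = fun t => 2 * π / σ.length * deriv g (σ.normalizedArcLength t) := by
    funext t
    have := σ.speed_pos t
    rw [curvature_eq hϑ.differentiable hT, ← deriv_comp_mul_deriv hg hl hgϑ t,
      deriv_normalizedArcLength]
    field_simp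
  have hκ' : deriv σ.curvature t = 2 * π / σ.length *
      (deriv (deriv g) (σ.normalizedArcLength t) * (2 * π / σ.length * σ.speed t)) := by
    rw [hκ]
    exact (((hg.smooth_deriv.differentiable (by simp) _).hasDerivAt.comp t
      (σ.hasDerivAt_normalizedArcLength t)).const_mul _).deriv
  simp only [grad]
  rw [hκ', hκ, deriv_normalizedArcLength]
  have := σ.speed_pos t
  have := hg.deriv_pos (σ.normalizedArcLength t)
  have := pi_pos
  field_simp

/-- Here g' is the normalized radius of curvature: κ = (2π/L) / g'(ϑ). One factor 2π/L survives. -/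
lemma energyGStar_eq {g : ℝ → ℝ} (hg : IsCircleLift g) (hϑ : IsCircleLift ϑ)
    (hgϑ : ∀ t, g (ϑ t) = σ.normalizedArcLength t)
    (hT : ∀ t, σ.unitTangent t = !₂[cos (ϑ t), sin (ϑ t)]) :
    σ.energyGStar = 2 * π / σ.length * liftEnergy g := by
  rw [hg.liftEnergy_eq_integral_comp hϑ, mul_add, ← intervalIntegral.integral_const_mul]
  unfold energyGStar integral
  have hL := σ.length_pos
  congr 1
  swap
  · field_simp
  refine intervalIntegral.integral_congr fun t _ => ?_
  have hϑ' : ∀ t, deriv ϑ t = 2 * π / σ.length * σ.speed t / deriv g (ϑ t) := fun t => by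
    rw [eq_div_iff (hg.deriv_pos _).ne', mul_comm, deriv_comp_mul_deriv hg hϑ hgϑ t,
      deriv_normalizedArcLength]
  have hκ : σ.curvature = fun t => 2 * π / σ.length / deriv g (ϑ t) := by
    funext t
    have := σ.speed_pos t
    have := hg.deriv_pos (ϑ t)
    rw [curvature_eq hϑ.differentiable hT, hϑ']
    field_simp
  have hκ' : deriv σ.curvature t = -(2 * π / σ.length *
      (deriv (deriv g) (ϑ t) * deriv ϑ t)) / deriv g (ϑ t) ^ 2 := by
    rw [hκ]
    have h1 := (hg.smooth_deriv.differentiable (by simp) (ϑ t)).hasDerivAt.comp t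
      (hϑ.differentiable t).hasDerivAt
    refine (((hasDerivAt_const t (2 * π / σ.length)).div h1 (hg.deriv_pos _).ne').congr_deriv
      ?_).deriv
    simp
  simp only [grad]
  rw [hκ', hκ, hϑ']
  have := σ.speed_pos t
  have := hg.deriv_pos (ϑ t)
  have := pi_pos
  field_simp

lemma StrictlyConvex.exists_isCircleLift (hσ : σ.StrictlyConvex) : ∃ ϑ, IsCircleLift ϑ ∧
    ∀ t, σ.unitTangent t = !₂[cos (ϑ t), sin (ϑ t)] := by
  obtain ⟨ϑ, η, hϑ, hη, hl, -, hp, hT⟩ := hσ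
  have hd : Differentiable ℝ ϑ := hϑ.differentiable (by simp)
  refine ⟨ϑ, ⟨hϑ, ?_, hp⟩, hT⟩
  have hne : ∀ t, deriv ϑ t ≠ 0 := fun t h0 => by
    have h1 := (hη.differentiable (by simp) (ϑ t)).hasDerivAt.comp t (hd t).hasDerivAt
    rw [show η ∘ ϑ = id from funext hl, h0, mul_zero] at h1
    exact zero_ne_one (h1.unique (hasDerivAt_id t))
  -- The derivative never vanishes and equals 1 somewhere, its mean over a period being 1; hence it
  -- is positive everywhere.
  obtain ⟨c, -, hc⟩ := exists_deriv_eq_slope ϑ two_pi_pos hd.continuous.continuousOn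
    hd.differentiableOn
  have h2 := hp 0
  rw [zero_add] at h2
  rw [h2, add_sub_cancel_left, sub_zero, div_self two_pi_pos.ne'] at hc
  intro t
  by_contra hneg
  obtain ⟨z, hz⟩ := mem_range_of_exists_le_of_exists_ge (c := 0)
    (hϑ.continuous_deriv (by simp)) ⟨t, not_lt.1 hneg⟩ ⟨c, by rw [hc]; exact zero_le_one⟩
  exact hne z hz

lemma toEuclideanLin_circlePoint (A : Matrix (Fin 2) (Fin 2) ℝ) (x : ℝ) (i : Fin 2) :
    Matrix.toEuclideanLin A (circlePoint x) i = A i 0 * cos x + A i 1 * sin x := by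
  fin_cases i <;> simp [circlePoint]

lemma isOval_iff (hσ : σ.StrictlyConvex)
    (hT : ∀ t, σ.unitTangent t = !₂[cos (ϑ t), sin (ϑ t)]) :
    σ.IsOval ↔ MoebiusRelated ϑ σ.normalizedArcLength := by
  constructor
  · rintro ⟨-, A, h⟩
    have hdet := A.2
    rw [Matrix.det_fin_two] at hdet
    -- The quarter turn `standardTangent` is absorbed into the matrix; the converse undoes it.
    refine ⟨-A.1 1 0, -A.1 1 1, A.1 0 0, A.1 0 1, by linarith, fun t => ?_⟩
    have h1 := h t
    rw [hT] at h1
    change _ = standardTangent (moebius A (circlePoint (σ.normalizedArcLength t))) at h1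
    have c0 := congrArg (fun p : Plane => p 0) h1
    have c1 := congrArg (fun p : Plane => p 1) h1
    simp only [standardTangent, moebius, PiLp.smul_apply, smul_eq_mul,
      toEuclideanLin_circlePoint, Matrix.cons_val_zero, Matrix.cons_val_one] at c0 c1
    set r := ‖Matrix.toEuclideanLin A.1 (circlePoint (σ.normalizedArcLength t))‖ with hr
    have hr0 : r ≠ 0 := by
      intro h0
      rw [h0] at c0 c1
      simp only [inv_zero, zero_mul, neg_zero] at c0 c1
      have := sin_sq_add_cos_sq (ϑ t)
      rw [c0, c1] at this
      simp at this
    refine ⟨r, lt_of_le_of_ne (norm_nonneg _) hr0.symm, ?_, ?_⟩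
    · rw [c0]; field_simp; ring
    · rw [c1]; field_simp
  · rintro ⟨a, b, c, d, hdet, h⟩
    refine ⟨hσ, ⟨!![c, d; -a, -b], by rw [Matrix.det_fin_two_of]; linarith⟩, fun t => ?_⟩
    obtain ⟨r, hr, h1, h2⟩ := h t
    rw [hT]
    change _ = standardTangent (moebius _ (circlePoint (σ.normalizedArcLength t)))
    have e0 := toEuclideanLin_circlePoint !![c, d; -a, -b] (σ.normalizedArcLength t) 0
    have e1 := toEuclideanLin_circlePoint !![c, d; -a, -b] (σ.normalizedArcLength t) 1
    simp only [Matrix.of_apply, Matrix.cons_val_zero, Matrix.cons_val_one, Matrix.cons_val'] at e0 e1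
    rw [← h2] at e0
    replace e1 := e1.trans (show _ = -(r * cos (ϑ t)) by rw [h1]; ring)
    have hn : ‖Matrix.toEuclideanLin !![c, d; -a, -b] (circlePoint (σ.normalizedArcLength t))‖
        = r := by
      rw [EuclideanSpace.norm_eq, Fin.sum_univ_two, e0, e1, norm_eq_abs, norm_eq_abs, sq_abs,
        sq_abs, show (r * sin (ϑ t)) ^ 2 + (-(r * cos (ϑ t))) ^ 2 = r ^ 2 by
          linear_combination r ^ 2 * sin_sq_add_cos_sq (ϑ t), sqrt_sq hr.le]
    ext i
    fin_cases i
    · simp [standardTangent, moebius, hn, e1, hr.ne']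
    · simp [standardTangent, moebius, hn, e0, hr.ne']

end SmoothClosedCurve

theorem theorem1 (σ : SmoothClosedCurve) (hσ : σ.StrictlyConvex) :
    (0 ≤ σ.energyG ∧ (σ.energyG = 0 ↔ σ.IsOval)) ∧
    (0 ≤ σ.energyGStar ∧ (σ.energyGStar = 0 ↔ σ.IsOval)) := by
  obtain ⟨ϑ, hϑ, hT⟩ := hσ.exists_isCircleLift
  have hl := σ.isCircleLift_normalizedArcLength
  obtain ⟨η, hη, hηl, -⟩ := hϑ.exists_inverse
  obtain ⟨μ, hμ, hμl, -⟩ := hl.exists_inverse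
  have hL : 0 < 2 * π / σ.length := div_pos two_pi_pos σ.length_pos
  have hoval := SmoothClosedCurve.isOval_iff hσ hT
  constructor
  · have hg := hϑ.comp hμ
    have hgϑ : ∀ t, (ϑ ∘ μ) (σ.normalizedArcLength t) = ϑ t := fun t => congrArg ϑ (hμl t)
    have hb := SmoothClosedCurve.not_isUnbalanced_angle hg hgϑ hT
    rw [SmoothClosedCurve.energyG_eq hg hϑ hgϑ hT, hoval, hg.liftEnergy_eq_zero_iff hb,
      ← moebiusRelated_comp_iff hl.surjective, funext (f := (ϑ ∘ μ) ∘ σ.normalizedArcLength) hgϑ]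
    exact ⟨hg.liftEnergy_nonneg hb, Iff.rfl⟩
  · have hg := hl.comp hη
    have hgϑ : ∀ t, (σ.normalizedArcLength ∘ η) (ϑ t) = σ.normalizedArcLength t :=
      fun t => congrArg σ.normalizedArcLength (hηl t)
    have hb := SmoothClosedCurve.not_isUnbalanced_arcLength hg hϑ hgϑ hT
    rw [SmoothClosedCurve.energyGStar_eq hg hϑ hgϑ hT, hoval,
      mul_eq_zero_iff_left hL.ne', hg.liftEnergy_eq_zero_iff hb,
      ← moebiusRelated_comp_iff hϑ.surjective,
      funext (f := (σ.normalizedArcLength ∘ η) ∘ ϑ) hgϑ]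
    -- Here g sends ϑ to s, so the relation comes out inverted.
    exact ⟨mul_nonneg hL.le (hg.liftEnergy_nonneg hb), MoebiusRelated.symm, MoebiusRelated.symm⟩
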